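/- **Models.** A *CREW PRAM algorithm* (for a given input size) has $P$ processors and $M$ shared memory cells; cells hold words of $w$ bits and a processor has a state of $s$ bits (initially zero). In each synchronous time step every processor, depending on its identifier and its state, performs a local computation, reads one cell, writes one cell, or halts; the reads of a step see the memory before the writes of that step; concurrent reads are allowed, concurrent writes to one cell are not. The input $x$ is the initial content of the shared memory. The running time on $x$ is the number of the first step in which all processors halt. An *EMPC algorithm* runs on $p$ machines, pairwise connected, each with a limited main memory and an external memory. In each synchronous round every machine first performs local computation and then the machines exchange messages. Local computation is a sequence of operations determined by the machine and the content of its main memory: compute in main memory, read or write one word of its external memory, send a message from main memory to a machine, take the next received message into main memory, or end the round with or without a vote for termination; the algorithm terminates with the first round in which all machines vote for termination. The number and length of messages in a round are not limited, but all waiting messages count as external memory. Memory is measured in bits. As in the PRAM, the programs may depend on the input size, and the local computation is otherwise unrestricted. Initially the input is in external memory, and all other memory is blank. **Theorem.** Let $p\ge 1$ be a constant and let $K$ be a constant. There is a constant $C>0$, depending only on $p$ and $K$, such that the following holds for all $P,M$ with $PM\ge 2$ and all $w,s$ with $w+s\le K(\log P+\log M)$ (in particular, for constant word length $w$ and constant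 state size $s$). For every CREW PRAM algorithm with $P$ processors, $M$ memory cells, word length $w$ and state size $s$, and for every partition of the $M$ cells among the $p$ machines, there is an EMPC algorithm on $p$ machines, with external memory words of $w+s$ bits, in which each cell is assigned its own word in the external memory of the machine that holds it, such that: 1. the total main memory of the $p$ machines is at most $C(\log P+\log M)$; 2. for every input $x$ and every $t$ such that the PRAM algorithm obeys the exclusive-write rule during its first $t$ steps on $x$, the EMPC algorithm started on $x$ completes its first $2t$ rounds, uses at most $C(\log P+\log M)(P+M)$ total external memory in each of them, and for every $k\le t$ the words assigned to the cells hold, after $2k$ rounds, the content of the PRAM memory after $k$ steps; 3. if in addition the PRAM algorithm runs in time $t$ on $x$, then the EMPC algorithm terminates after exactly $2t$ rounds. -/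

import Mathlib

/-! ## CREW PRAM -/

/-- What a PRAM processor does in one time step: a local computation, a read of one shared cell
(the next state depends on the word that is read), a write of one shared cell, or `halt`
(a halted processor keeps its state, hence stays halted). -/
inductive PRAMAction (M w s : ℕ) where
  | compute (next : BitVec s)
  | read (addr : Fin M) (next : BitVec w → BitVec s)
  | write (addr : Fin M) (value : BitVec w) (next : BitVec s)
  | halt

/-- A PRAM algorithm (for one input size) with `P` processors, `M` shared memory cells, words of
`w` bits and processor states of `s` bits.  The action of a processor is determined by its
identifier and its state; the local computation inside a step is unrestricted. -/
structure PRAM (P M w s : ℕ) where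
  action : Fin P → BitVec s → PRAMAction M w s

structure PRAMConfig (P M w s : ℕ) where
  state : Fin P → BitVec s
  mem : Fin M → BitVec w

namespace PRAM

variable {P M w s : ℕ}

/-- The word that an action writes to cell `a`, if it writes to `a`. -/
def writeTo (act : PRAMAction M w s) (a : Fin M) : Option (BitVec w) :=
  match act with
  | .write b v _ => if b = a then some v else none
  | _ => none

/-- The state of a processor after performing `act` in state `q` with shared memory `mem`. -/
def nextState (act : PRAMAction M w s) (mem : Fin M → BitVec w) (q : BitVec s) : BitVec s :=
  match act with
  | .compute q' => q'
  | .read a f => f (mem a)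
  | .write _ _ q' => q'
  | .halt => q

/-- One synchronous time step: all reads see the memory as it was before the step, then all writes
take effect.  (With exclusive writes at most one processor writes to a given cell, so the search
for the first writer finds the only one.) -/
def step (A : PRAM P M w s) (c : PRAMConfig P M w s) : PRAMConfig P M w s where
  state i := nextState (A.action i (c.state i)) c.mem (c.state i)
  mem a := ((List.finRange P).findSome? fun i => writeTo (A.action i (c.state i)) a).getD (c.mem a)

/-- Initially the input is in the shared memory and all processor states are zero. -/
def init (x : Fin M → BitVec w) : PRAMConfig P M w s where
  state _ := 0
  mem := x

/-- The configuration on input `x` after `k` steps. -/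
def config (A : PRAM P M w s) (x : Fin M → BitVec w) (k : ℕ) : PRAMConfig P M w s :=
  A.step^[k] (init x)

/-- The exclusive-write rule of the CREW PRAM during the first `t` steps on input `x`: no two
processors write to the same cell in the same step.  Reads are not restricted. -/
def ExclusiveWrite (A : PRAM P M w s) (x : Fin M → BitVec w) (t : ℕ) : Prop :=
  ∀ k < t, ∀ i j : Fin P, ∀ a : Fin M,
    (writeTo (A.action i ((A.config x k).state i)) a).isSome →
    (writeTo (A.action j ((A.config x k).state j)) a).isSome → i = j

/-- Every processor performs `halt` in configuration `c`. -/
def AllHalt (A : PRAM P M w s) (c : PRAMConfig P M w s) : Prop :=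
  ∀ i, A.action i (c.state i) = .halt

/-- `A` runs in time exactly `t` on input `x`: step number `t` is the first one in which all
processors perform `halt`. -/
def RunsInTime (A : PRAM P M w s) (x : Fin M → BitVec w) (t : ℕ) : Prop :=
  ∃ k, t = k + 1 ∧ A.AllHalt (A.config x k) ∧ ∀ j < k, ¬ A.AllHalt (A.config x j)

end PRAM

/-! ## EMPC -/

/-- The elementary operations of an EMPC machine with `m` bits of working main memory, `E` words of
`b` bits of external memory, and messages of `μ` bits, in a network of `p` machines.  The arguments
`next` give the new content of the working main memory. -/
inductive EMPCInstr (p b E m μ : ℕ) where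
  /-- computation in main memory -/
  | compute (next : BitVec m)
  /-- IO: read one word of external memory into main memory -/
  | read (addr : Fin E) (next : BitVec b → BitVec m)
  /-- IO: write one word from main memory to external memory -/
  | write (addr : Fin E) (value : BitVec b) (next : BitVec m)
  /-- send a message from main memory to machine `dest` (which may be the sender itself) -/
  | send (dest : Fin p) (msg : BitVec μ) (next : BitVec m)
  /-- take the next received message into main memory; `none` if all of them have been taken -/
  | receive (next : Option (BitVec μ) → BitVec m)
  /-- finish the local computation of this round, voting for termination or not -/
  | endRound (next : BitVec m) (vote : Bool)

/-- An EMPC algorithm (for one input size) on `p` machines.  The program of a machine determines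
the next operation from the content of its working main memory alone. -/
structure EMPC (p b E m μ : ℕ) where
  program : Fin p → BitVec m → EMPCInstr p b E m μ

/-- One machine during the local computation of a round: `inbox` holds the received messages that
it has not taken yet, `outbox` those that it has sent so far, with their destinations. -/
structure EMPCLocal (p b E m μ : ℕ) where
  main : BitVec m
  ext : Fin E → BitVec b
  inbox : List (BitVec μ)
  outbox : List (Fin p × BitVec μ)

/-- The whole system between two rounds. -/
structure EMPCConfig (p b E m μ : ℕ) where
  main : Fin p → BitVec m
  ext : Fin p → Fin E → BitVec b
  /-- the messages received at the end of the previous round -/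
  inbox : Fin p → List (BitVec μ)
  /-- the votes for termination cast in the previous round -/
  vote : Fin p → Bool

namespace EMPC

variable {p b E m μ : ℕ}

/-- `LocalRun prog σ τ v`: the local computation of a machine with program `prog`, started in `σ`,
terminates in `τ` with vote `v`. -/
inductive LocalRun (prog : BitVec m → EMPCInstr p b E m μ) :
    EMPCLocal p b E m μ → EMPCLocal p b E m μ → Bool → Prop where
  | compute {σ τ v q} (h : prog σ.main = .compute q)
      (hr : LocalRun prog { σ with main := q } τ v) : LocalRun prog σ τ v
  | read {σ τ v e f} (h : prog σ.main = .read e f)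
      (hr : LocalRun prog { σ with main := f (σ.ext e) } τ v) : LocalRun prog σ τ v
  | write {σ τ v e y q} (h : prog σ.main = .write e y q)
      (hr : LocalRun prog { σ with main := q, ext := Function.update σ.ext e y } τ v) :
      LocalRun prog σ τ v
  | send {σ τ v d y q} (h : prog σ.main = .send d y q)
      (hr : LocalRun prog { σ with main := q, outbox := σ.outbox ++ [(d, y)] } τ v) :
      LocalRun prog σ τ v
  | receive {σ τ v f} (h : prog σ.main = .receive f)
      (hr : LocalRun prog { σ with main := f σ.inbox.head?, inbox := σ.inbox.tail } τ v) :
      LocalRun prog σ τ v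
  | endRound {σ q v} (h : prog σ.main = .endRound q v) : LocalRun prog σ { σ with main := q } v

/-- One synchronous round: every machine performs its local computation, then the messages are
exchanged.  Each machine finds its messages ordered by sender, those of one sender in the order in
which they were sent. -/
def Round (B : EMPC p b E m μ) (c c' : EMPCConfig p b E m μ) : Prop :=
  ∃ (out : Fin p → List (Fin p × BitVec μ)) (rest : Fin p → List (BitVec μ)),
    (∀ i, LocalRun (B.program i) ⟨c.main i, c.ext i, c.inbox i, []⟩
      ⟨c'.main i, c'.ext i, rest i, out i⟩ (c'.vote i)) ∧
    ∀ j, c'.inbox j = (List.finRange p).flatMap fun i =>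
      (out i).filterMap fun d => if d.1 = j then some d.2 else none

/-- The computation terminates with the first round in which all machines vote for it. -/
def Terminated (c : EMPCConfig p b E m μ) : Prop := ∀ i, c.vote i = true

/-- The algorithm, following the sequence `c` of configurations, runs in exactly `R` rounds. -/
def RunsInRounds (c : ℕ → EMPCConfig p b E m μ) (R : ℕ) : Prop :=
  Terminated (c R) ∧ ∀ r < R, ¬ Terminated (c r)

/-- The content `x` of `M` shared cells is stored in the working external memory of `c`: cell `a`
is held by machine `owner a` in the external memory word `loc a`. -/
def Stores {M w : ℕ} (owner : Fin M → Fin p) (loc : Fin M → Fin E)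
    (c : EMPCConfig p b E m μ) (x : Fin M → BitVec w) : Prop :=
  ∀ a, c.ext (owner a) (loc a) = (x a).setWidth b

/-- The initial configuration for input `x`: the input is in the working external memory, and
everything else is blank. -/
def IsInitial {M w : ℕ} (owner : Fin M → Fin p) (loc : Fin M → Fin E)
    (c : EMPCConfig p b E m μ) (x : Fin M → BitVec w) : Prop :=
  Stores owner loc c x ∧
  (∀ i e, (∀ a, (owner a, loc a) ≠ (i, e)) → c.ext i e = 0) ∧
  (∀ i, c.main i = 0) ∧ (∀ i, c.inbox i = []) ∧ (∀ i, c.vote i = false)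

/-- Total main memory of the `p` machines in bits: for each machine its working memory, and
buffers for one external memory word and for one message. -/
def totalMainBits (_B : EMPC p b E m μ) : ℕ := p * (m + b + μ)

/-- Total external memory, in bits, used in the round that leads from `c` to `c'`: the words of
external memory of all machines, the messages received before the round, and the messages
sent in it. -/
def totalExternalBits (_B : EMPC p b E m μ) (c c' : EMPCConfig p b E m μ) : ℕ :=
  p * (E * b) + μ * (∑ i, (c.inbox i).length + ∑ i, (c'.inbox i).length)

end EMPC

/-! One machine, `head`, keeps the states of all processors in external memory and holds one
processor at a time in main memory. A PRAM step takes two rounds: requests, then service. A third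
round for the read results is avoided because `head` takes them in at the start of the next step's
first round.

A request is just a pair (processor, state). Programs may depend on the PRAM algorithm, so the owner
of the cell recomputes the action, and with it address and value. Messages and main memory thus need
only about `log P + s` bits, and a word of `w + s` bits can hold either a cell or a state.

`head` scans the states twice, sending first all read requests and then all write requests. It is
the only sender and order is preserved, so every machine serves its reads before its writes, and
reads see the old memory. Exclusive writing makes the order among the writes irrelevant. The vote of
`head` in the second round says whether all processors halted; the other machines always agree.

The correctness of each phase is in the `localRun_*` lemmas, the ordering of messages in
`deliver_requests`, the return of read results in `exists_deliver_replies`; the two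
`round_*Config_*` lemmas combine them. -/

/-! ## Data extracted from a PRAM action -/

namespace PRAMAction

variable {M w s : ℕ}

/-- The cell that an action reads. -/
def readAddr : PRAMAction M w s → Option (Fin M)
  | .read a _ => some a
  | _ => none

/-- The cell that an action writes. -/
def writeAddr : PRAMAction M w s → Option (Fin M)
  | .write a _ _ => some a
  | _ => none

/-- Whether an action is `halt`. -/
def isHalt : PRAMAction M w s → Bool
  | .halt => true
  | _ => false

theorem isHalt_iff (act : PRAMAction M w s) : act.isHalt = true ↔ act = .halt := by
  cases act <;> simp [isHalt]

/-- The next state as far as it is known without access to the shared memory: a reading processor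
keeps its state for the time being. -/
def pendingState (act : PRAMAction M w s) (q : BitVec s) : BitVec s :=
  match act with
  | .compute q' => q'
  | .write _ _ q' => q'
  | _ => q

theorem pendingState_eq_nextState {act : PRAMAction M w s} (h : act.readAddr = none)
    (mem : Fin M → BitVec w) (q : BitVec s) :
    act.pendingState q = PRAM.nextState act mem q := by
  cases act <;> simp_all [readAddr, pendingState, PRAM.nextState]

theorem writeTo_eq_some_iff {act : PRAMAction M w s} {a : Fin M} {v : BitVec w} :
    PRAM.writeTo act a = some v ↔ ∃ q, act = .write a v q := by
  cases act <;> simp [PRAM.writeTo]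

theorem writeAddr_eq_some_iff {act : PRAMAction M w s} {a : Fin M} :
    act.writeAddr = some a ↔ ∃ v q, act = .write a v q := by
  cases act <;> simp [writeAddr]

theorem readAddr_eq_some_iff {act : PRAMAction M w s} {a : Fin M} :
    act.readAddr = some a ↔ ∃ f, act = .read a f := by
  cases act <;> simp [readAddr]

end PRAMAction

/-! ## The memory after an exclusive-write step -/

namespace PRAM

variable {P M w s : ℕ}

/-- `step` selects the first writer in processor order; exclusiveness identifies it with any given
writer. The exclusive-write rule enters the simulation only here. -/
theorem step_mem_of_write (A : PRAM P M w s) (c : PRAMConfig P M w s)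
    (hex : ∀ i j : Fin P, ∀ a : Fin M, (writeTo (A.action i (c.state i)) a).isSome →
      (writeTo (A.action j (c.state j)) a).isSome → i = j)
    {i : Fin P} {a : Fin M} {v : BitVec w} (h : writeTo (A.action i (c.state i)) a = some v) :
    (A.step c).mem a = v := by
  have hs : ((List.finRange P).findSome? fun j => writeTo (A.action j (c.state j)) a) = some v := by
    cases hf : (List.finRange P).findSome? fun j => writeTo (A.action j (c.state j)) a with
    | none =>
      rw [List.findSome?_eq_none_iff] at hf
      simp [hf i (List.mem_finRange i)] at h
    | some v' =>
      obtain ⟨j, -, hj⟩ := List.exists_of_findSome?_eq_some hf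
      obtain rfl := hex i j a (by simp [h]) (by simp [hj])
      rw [← hj, h]
  simp [step, hs]

theorem step_mem_of_not_write (A : PRAM P M w s) (c : PRAMConfig P M w s) {a : Fin M}
    (h : ∀ i, writeTo (A.action i (c.state i)) a = none) : (A.step c).mem a = c.mem a := by
  have hs : ((List.finRange P).findSome? fun j => writeTo (A.action j (c.state j)) a) = none := by
    rw [List.findSome?_eq_none_iff]
    exact fun i _ => h i
  simp [step, hs]

theorem config_succ (A : PRAM P M w s) (x : Fin M → BitVec w) (k : ℕ) :
    A.config x (k + 1) = A.step (A.config x k) :=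
  Function.iterate_succ_apply' _ _ _

end PRAM

/-! ## The simulating program -/

/-- The contents of main memory of a machine of the simulation. -/
inductive SimControl (P s : ℕ) where
  -- The contents up to `update` belong to the request round, those from `serve` on to the service
  -- round. The flag of `scanWrites` collects the halting tests and is carried along as the vote of
  -- `head`.
  | absorb
  | store (i : Fin P) (q : BitVec s)
  | scanReads (n : Fin (P + 1))
  | request (i : Fin P) (q : BitVec s)
  | scanWrites (n : Fin (P + 1)) (halted : Bool)
  | advance (i : Fin P) (q : BitVec s) (halted : Bool)
  | update (i : Fin P) (q : BitVec s) (halted : Bool)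
  | serve (vote : Bool)
  | perform (i : Fin P) (q : BitVec s) (vote : Bool)
  | reply (i : Fin P) (q : BitVec s) (vote : Bool)
  | finish (vote : Bool)

/-- Binary encodings of the main memory and of the messages of the simulation. A message consists
of a processor and a state of it. -/
structure SimCodec (P s m μ : ℕ) where
  enc : SimControl P s → BitVec m
  dec : BitVec m → SimControl P s
  dec_enc : ∀ x, dec (enc x) = x
  enc_absorb : enc .absorb = 0
  menc : Fin P × BitVec s → BitVec μ
  mdec : BitVec μ → Fin P × BitVec s
  mdec_menc : ∀ x, mdec (menc x) = x

/-! ### Binary encodings -/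

/-- An injection into a type with at most `2 ^ m` elements gives an encoding by `m` bits in which
a chosen element is encoded by zero. -/
theorem exists_bitVec_encoding {S T : Type*} [Fintype T] (f : S → T) (hf : Function.Injective f)
    (s₀ : S) {m : ℕ} (hm : Fintype.card T ≤ 2 ^ m) :
    ∃ (enc : S → BitVec m) (dec : BitVec m → S), (∀ x, dec (enc x) = x) ∧ enc s₀ = 0 := by
  classical
  let g : S → BitVec m := fun x =>
    BitVec.ofFin (Fin.castLE hm (Fintype.equivFin T (f x)))
  have hg : Function.Injective g := by
    intro x y h
    have h1 := congrArg BitVec.toFin h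
    exact hf ((Fintype.equivFin T).injective (Fin.castLE_injective hm h1))
  let e : S → BitVec m := fun x => Equiv.swap (g s₀) 0 (g x)
  have he : Function.Injective e := (Equiv.swap (g s₀) 0).injective.comp hg
  have : Nonempty S := ⟨s₀⟩
  exact ⟨e, Function.invFun e, Function.leftInverse_invFun he, by simp [e]⟩

/-- The fields of a main memory content, with a tag for its kind. -/
def SimControl.fields {P s : ℕ} :
    SimControl P s → Fin 16 × Fin (P + 1) × BitVec s × Bool
  | .absorb => (0, 0, 0, false)
  | .store i q => (1, i.castSucc, q, false)
  | .scanReads n => (2, n, 0, false)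
  | .request i q => (3, i.castSucc, q, false)
  | .scanWrites n b => (4, n, 0, b)
  | .advance i q b => (5, i.castSucc, q, b)
  | .update i q b => (6, i.castSucc, q, b)
  | .serve b => (7, 0, 0, b)
  | .perform i q b => (8, i.castSucc, q, b)
  | .reply i q b => (9, i.castSucc, q, b)
  | .finish b => (10, 0, 0, b)

theorem SimControl.fields_injective {P s : ℕ} :
    Function.Injective (SimControl.fields : SimControl P s → _) := by
  intro x y h
  cases x <;> cases y <;> simp_all [SimControl.fields]

/-- The tag takes 4 bits, a scan position (`P` processors and an end mark) `Nat.log 2 P + 1`, a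
state `s` and the flag 1; one bit of the 7 is slack. Encoding `absorb` by zero makes blank main
memory a valid start. -/
theorem nonempty_simCodec {P : ℕ} (hP : 0 < P) (s : ℕ) :
    Nonempty (SimCodec P s (Nat.log 2 P + s + 7) (Nat.log 2 P + s + 1)) := by
  have hlog : P < 2 ^ (Nat.log 2 P + 1) := Nat.lt_pow_succ_log_self (by norm_num) P
  have hcard : Fintype.card (BitVec s) = 2 ^ s := by
    rw [Fintype.card_congr (BitVec.equivFin (m := s)).toEquiv, Fintype.card_fin]
  obtain ⟨e, d, hed, he⟩ := exists_bitVec_encoding (m := Nat.log 2 P + s + 7)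
    SimControl.fields (SimControl.fields_injective (P := P) (s := s)) .absorb (by
      simp only [Fintype.card_prod, Fintype.card_fin, hcard, Fintype.card_bool]
      calc 16 * ((P + 1) * (2 ^ s * 2)) ≤ 16 * (2 ^ (Nat.log 2 P + 1) * (2 ^ s * 2)) := by
            gcongr; omega
        _ ≤ 2 ^ (Nat.log 2 P + s + 7) := by
            rw [show 16 * (2 ^ (Nat.log 2 P + 1) * (2 ^ s * 2)) = 2 ^ (Nat.log 2 P + s + 6) by ring]
            exact Nat.pow_le_pow_right (by norm_num) (by omega))
  obtain ⟨e', d', hed', -⟩ := exists_bitVec_encoding (m := Nat.log 2 P + s + 1)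
    (id : Fin P × BitVec s → _) Function.injective_id (⟨0, hP⟩, 0) (by
      simp only [Fintype.card_prod, Fintype.card_fin, hcard]
      calc P * 2 ^ s ≤ 2 ^ (Nat.log 2 P + 1) * 2 ^ s := by gcongr
        _ = 2 ^ (Nat.log 2 P + s + 1) := by ring)
  exact ⟨⟨e, d, hed, he, e', d', hed'⟩⟩

section Simulation

variable {p P M w s m μ : ℕ}

/-- The operation that machine `j` performs, given the content of its main memory. The states of
all processors are kept by the machine `head`. In odd rounds it completes the reads of the previous
step and sends out first the read requests and then the write requests of the current step; in
even rounds all machines serve these requests. -/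
def simInstr (A : PRAM P M w s) (owner : Fin M → Fin p) (head : Fin p) (κ : SimCodec P s m μ)
    (j : Fin p) : SimControl P s → EMPCInstr p (w + s) (M + P) m μ
  | .absorb =>
    if j = head then
      .receive fun o => κ.enc (match o.map κ.mdec with
        | none => .scanReads 0
        | some r => .store r.1 r.2)
    -- No machine votes for termination in an odd round. Outside `head` the vote of the next round
    -- is always yes, which leaves the decision to `head`.
    else .endRound (κ.enc (.serve true)) false
  | .store i q => .write (Fin.natAdd M i) (q.setWidth (w + s)) (κ.enc .absorb)
  | .scanReads n =>
    Fin.lastCases (motive := fun _ => EMPCInstr p (w + s) (M + P) m μ)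
      (.compute (κ.enc (.scanWrites 0 true)))
      (fun i => .read (Fin.natAdd M i) fun y => κ.enc (.request i (y.setWidth s))) n
  | .request i q =>
    match (A.action i q).readAddr with
    | some a => .send (owner a) (κ.menc (i, q)) (κ.enc (.scanReads i.succ))
    | none => .compute (κ.enc (.scanReads i.succ))
  | .scanWrites n b =>
    Fin.lastCases (motive := fun _ => EMPCInstr p (w + s) (M + P) m μ)
      (.endRound (κ.enc (.serve b)) false)
      (fun i => .read (Fin.natAdd M i) fun y => κ.enc (.advance i (y.setWidth s) b)) n
  -- The request carries the old state `q`, on which the owner reevaluates the action; only the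
  -- stored state advances.
  | .advance i q b =>
    match (A.action i q).writeAddr with
    | some a => .send (owner a) (κ.menc (i, q))
        (κ.enc (.update i ((A.action i q).pendingState q) (b && (A.action i q).isHalt)))
    | none => .compute
        (κ.enc (.update i ((A.action i q).pendingState q) (b && (A.action i q).isHalt)))
  | .update i q b => .write (Fin.natAdd M i) (q.setWidth (w + s)) (κ.enc (.scanWrites i.succ b))
  | .serve b => .receive fun o => κ.enc (match o.map κ.mdec with
      | none => .finish b
      | some r => .perform r.1 r.2 b)
  | .perform i q b =>
    match A.action i q with
    | .read a f => .read (Fin.castAdd P a) fun y => κ.enc (.reply i (f (y.setWidth w)) b)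
    | .write a v _ => .write (Fin.castAdd P a) (v.setWidth (w + s)) (κ.enc (.serve b))
    | _ => .compute (κ.enc (.serve b))
  | .reply i q b => .send head (κ.menc (i, q)) (κ.enc (.serve b))
  | .finish b => .endRound (κ.enc .absorb) b

/-- The simulating algorithm. -/
def simEMPC (A : PRAM P M w s) (owner : Fin M → Fin p) (head : Fin p) (κ : SimCodec P s m μ) :
    EMPC p (w + s) (M + P) m μ where
  program j y := simInstr A owner head κ j (κ.dec y)

/-! ### Layout of the external memory -/

/-- The external memory of machine `j` when the shared memory is `mem` and the processor states
are `st`. -/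
def simExt (owner : Fin M → Fin p) (head j : Fin p) (mem : Fin M → BitVec w)
    (st : Fin P → BitVec s) : Fin (M + P) → BitVec (w + s) :=
  -- Every machine reserves a word for every cell and every processor, so that addresses do not
  -- depend on the partition; this costs only the constant factor `p`. Unused words stay zero, in
  -- accordance with the blank start.
  Fin.addCases (fun a => if owner a = j then (mem a).setWidth (w + s) else 0)
    (fun i => if j = head then (st i).setWidth (w + s) else 0)

theorem update_simExt_cell {owner : Fin M → Fin p} {head j : Fin p} {mem : Fin M → BitVec w}
    {st : Fin P → BitVec s} {a : Fin M} (ha : owner a = j) (v : BitVec w) :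
    Function.update (simExt owner head j mem st) (Fin.castAdd P a) (v.setWidth (w + s)) =
      simExt owner head j (Function.update mem a v) st := by
  funext e
  refine Fin.addCases (fun b => ?_) (fun i => ?_) e
  · by_cases h : b = a
    · subst h; simp [simExt, ha]
    · simp [simExt, Function.update_of_ne, h]
  · rw [Function.update_of_ne (by simp [Fin.ext_iff]; omega)]
    simp [simExt]

theorem update_simExt_state {owner : Fin M → Fin p} {head : Fin p} {mem : Fin M → BitVec w}
    {st : Fin P → BitVec s} (i : Fin P) (q : BitVec s) :
    Function.update (simExt owner head head mem st) (Fin.natAdd M i) (q.setWidth (w + s)) =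
      simExt owner head head mem (Function.update st i q) := by
  funext e
  refine Fin.addCases (fun b => ?_) (fun i' => ?_) e
  · rw [Function.update_of_ne (by simp [Fin.ext_iff]; omega)]
    simp [simExt]
  · by_cases h : i' = i
    · subst h; simp [simExt]
    · simp [simExt, Function.update_of_ne, h]

theorem simExt_congr {owner : Fin M → Fin p} {head j : Fin p} {mem mem' : Fin M → BitVec w}
    {st st' : Fin P → BitVec s} (hmem : ∀ a, owner a = j → mem a = mem' a)
    (hst : j = head → st = st') :
    simExt owner head j mem st = simExt owner head j mem' st' := by
  funext e
  refine Fin.addCases (fun b => ?_) (fun i' => ?_) e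
  · by_cases h : owner b = j
    · simp [simExt, h, hmem b h]
    · simp [simExt, h]
  · by_cases h : j = head
    · simp [simExt, h, hst h]
    · simp [simExt, h]

theorem simExt_cell {owner : Fin M → Fin p} {head j : Fin p} {mem : Fin M → BitVec w}
    {st : Fin P → BitVec s} {a : Fin M} (ha : owner a = j) :
    (simExt owner head j mem st (Fin.castAdd P a)).setWidth w = mem a := by
  simp [simExt, ha]

theorem simExt_state {owner : Fin M → Fin p} {head : Fin p} {mem : Fin M → BitVec w}
    {st : Fin P → BitVec s} (i : Fin P) :
    (simExt owner head head mem st (Fin.natAdd M i)).setWidth s = st i := by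
  simp [simExt]

theorem drop_finRange_castSucc (i : Fin P) :
    (List.finRange P).drop i.castSucc = i :: (List.finRange P).drop i.succ := by
  rw [List.drop_eq_getElem_cons (by simp)]
  simp

/-! ### Local computations -/

section LocalRuns

open EMPC

variable {A : PRAM P M w s} {owner : Fin M → Fin p} {head : Fin p} {κ : SimCodec P s m μ}
  {τ : EMPCLocal p (w + s) (M + P) m μ} {v : Bool}

/-- Runs are built backwards: `hrun` is the rest of the run, to which this phase is prefixed.
Replies may come in any order or repeatedly, since all carry the final state; what matters is that
each outdated state has one. -/
theorem localRun_absorb {mem : Fin M → BitVec w} {st' : Fin P → BitVec s}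
    {out : List (Fin p × BitVec μ)}
    (hrun : LocalRun ((simEMPC A owner head κ).program head)
      ⟨κ.enc (.scanReads 0), simExt owner head head mem st', [], out⟩ τ v)
    (l : List (Fin P × BitVec s)) (hl : ∀ r ∈ l, r.2 = st' r.1) (st : Fin P → BitVec s)
    (hst : ∀ i, st i = st' i ∨ ∃ r ∈ l, r.1 = i) :
    LocalRun ((simEMPC A owner head κ).program head)
      ⟨κ.enc .absorb, simExt owner head head mem st, l.map κ.menc, out⟩ τ v := by
  induction l generalizing st with
  | nil =>
    obtain rfl : st = st' := funext fun i => by simpa using hst i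
    refine .receive (by simp only [simEMPC, κ.dec_enc, simInstr, if_true]; rfl) ?_
    simpa using hrun
  | cons r l ih =>
    refine .receive (by simp only [simEMPC, κ.dec_enc, simInstr, if_true]; rfl) ?_
    simp only [List.map_cons, List.head?_cons, Option.map_some, κ.mdec_menc, List.tail_cons]
    refine .write (by simp only [simEMPC, κ.dec_enc, simInstr]; rfl) ?_
    simp only [update_simExt_state]
    refine ih (fun r' h => hl r' (List.mem_cons_of_mem _ h)) _ fun i => ?_
    by_cases hi : i = r.1
    · subst hi
      simp [hl r]
    · rcases hst i with h | ⟨r', hr', rfl⟩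
      · simp [Function.update_of_ne hi, h]
      · rcases List.mem_cons.1 hr' with rfl | h
        · exact absurd rfl hi
        · exact .inr ⟨r', h, rfl⟩

/-- `(List.finRange P).drop n` lists the processors still to be scanned, hence the induction
downwards from the last position. This scan leaves external memory unchanged, so the second scan
sees the same states. -/
theorem localRun_scanReads {mem : Fin M → BitVec w} {st : Fin P → BitVec s}
    {inb : List (BitVec μ)} (n : Fin (P + 1)) :
    ∀ out : List (Fin p × BitVec μ),
    LocalRun ((simEMPC A owner head κ).program head)
      ⟨κ.enc (.scanWrites 0 true), simExt owner head head mem st, inb,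
        out ++ ((List.finRange P).drop n).filterMap fun i =>
          (A.action i (st i)).readAddr.map fun a => (owner a, κ.menc (i, st i))⟩ τ v →
    LocalRun ((simEMPC A owner head κ).program head)
      ⟨κ.enc (.scanReads n), simExt owner head head mem st, inb, out⟩ τ v := by
  induction n using Fin.reverseInduction with
  | last =>
    intro out h
    refine .compute (by simp only [simEMPC, κ.dec_enc, simInstr, Fin.lastCases_last]; rfl) ?_
    simpa [List.drop_eq_nil_of_le] using h
  | cast i ih =>
    intro out h
    rw [drop_finRange_castSucc] at h
    refine .read (by simp only [simEMPC, κ.dec_enc, simInstr, Fin.lastCases_castSucc]; rfl) ?_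
    simp only [simExt_state]
    cases ha : (A.action i (st i)).readAddr with
    | none =>
      refine .compute (by simp only [simEMPC, κ.dec_enc, simInstr, ha]; rfl) ?_
      refine ih _ ?_
      simpa [List.filterMap_cons, ha] using h
    | some a =>
      refine .send (by simp only [simEMPC, κ.dec_enc, simInstr, ha]; rfl) ?_
      refine ih _ ?_
      simpa [List.filterMap_cons, ha] using h

/-- Invariant: the states `cur` before position `n` are already advanced, the others are still those
of `st`. Each processor is therefore evaluated in its old state. -/
theorem localRun_scanWrites {mem : Fin M → BitVec w} {st : Fin P → BitVec s}
    {inb : List (BitVec μ)} (n : Fin (P + 1)) :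
    ∀ (cur : Fin P → BitVec s) (b : Bool) (out : List (Fin p × BitVec μ)),
    (∀ i, cur i = if i.castSucc < n then (A.action i (st i)).pendingState (st i) else st i) →
    LocalRun ((simEMPC A owner head κ).program head)
      ⟨κ.enc (.scanWrites n b), simExt owner head head mem cur, inb, out⟩
      ⟨κ.enc (.serve (b && ((List.finRange P).drop n).all fun i => (A.action i (st i)).isHalt)),
        simExt owner head head mem (fun i => (A.action i (st i)).pendingState (st i)), inb,
        out ++ ((List.finRange P).drop n).filterMap fun i =>
          (A.action i (st i)).writeAddr.map fun a => (owner a, κ.menc (i, st i))⟩ false := by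
  induction n using Fin.reverseInduction with
  | last =>
    intro cur b out hcur
    obtain rfl : cur = fun i => (A.action i (st i)).pendingState (st i) :=
      funext fun i => by simpa [Fin.castSucc_lt_last] using hcur i
    have := LocalRun.endRound (prog := (simEMPC A owner head κ).program head)
      (σ := ⟨κ.enc (.scanWrites (Fin.last P) b), simExt owner head head mem
        (fun i => (A.action i (st i)).pendingState (st i)), inb, out⟩)
      (by simp only [simEMPC, κ.dec_enc, simInstr, Fin.lastCases_last]; rfl)
    simpa [List.drop_eq_nil_of_le] using this
  | cast i ih =>
    intro cur b out hcur
    have hi : cur i = st i := by simpa using hcur i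
    have hnext : ∀ i', Function.update cur i ((A.action i (st i)).pendingState (st i)) i' =
        if i'.castSucc < i.succ then (A.action i' (st i')).pendingState (st i') else st i' := by
      intro i'
      by_cases h : i' = i
      · subst h; simp
      · rw [Function.update_of_ne h, hcur i']
        have : i'.castSucc < i.succ ↔ i'.castSucc < i.castSucc := by
          simp only [Fin.lt_def, Fin.val_castSucc, Fin.val_succ]
          have := Fin.val_ne_of_ne h
          omega
        simp only [this]
    rw [drop_finRange_castSucc]
    refine .read (by simp only [simEMPC, κ.dec_enc, simInstr, Fin.lastCases_castSucc]; rfl) ?_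
    simp only [simExt_state, hi]
    cases ha : (A.action i (st i)).writeAddr with
    | none =>
      refine .compute (by simp only [simEMPC, κ.dec_enc, simInstr, ha]; rfl) ?_
      refine .write (by simp only [simEMPC, κ.dec_enc, simInstr]; rfl) ?_
      simp only [update_simExt_state]
      simpa [List.filterMap_cons, ha, Bool.and_assoc] using
        ih _ (b && (A.action i (st i)).isHalt) out hnext
    | some a =>
      refine .send (by simp only [simEMPC, κ.dec_enc, simInstr, ha]; rfl) ?_
      refine .write (by simp only [simEMPC, κ.dec_enc, simInstr]; rfl) ?_
      simp only [update_simExt_state]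
      simpa [List.filterMap_cons, ha, Bool.and_assoc] using
        ih _ (b && (A.action i (st i)).isHalt) (out ++ [(owner a, κ.menc (i, st i))]) hnext

/-- The remaining inbox `inb`, which will hold the write requests, is not touched meanwhile, so all
replies are computed from the same `mem`. -/
theorem localRun_serve_reads {j : Fin p} {mem : Fin M → BitVec w} {st st' : Fin P → BitVec s}
    {b : Bool} {inb : List (BitVec μ)} (l : List (Fin P))
    (hl : ∀ i ∈ l, ∃ a, (A.action i (st i)).readAddr = some a ∧ owner a = j) :
    ∀ out : List (Fin p × BitVec μ),
    LocalRun ((simEMPC A owner head κ).program j)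
      ⟨κ.enc (.serve b), simExt owner head j mem st', inb, out ++ l.map fun i =>
        (head, κ.menc (i, PRAM.nextState (A.action i (st i)) mem (st i)))⟩ τ v →
    LocalRun ((simEMPC A owner head κ).program j)
      ⟨κ.enc (.serve b), simExt owner head j mem st',
        (l.map fun i => κ.menc (i, st i)) ++ inb, out⟩ τ v := by
  induction l with
  | nil => simp
  | cons i l ih =>
    intro out h
    obtain ⟨a, ha, hj⟩ := hl i (by simp)
    obtain ⟨f, hf⟩ := PRAMAction.readAddr_eq_some_iff.1 ha
    refine .receive (by simp only [simEMPC, κ.dec_enc, simInstr]; rfl) ?_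
    simp only [List.map_cons, List.cons_append, List.head?_cons, Option.map_some, κ.mdec_menc,
      List.tail_cons]
    refine .read (by simp only [simEMPC, κ.dec_enc, simInstr, hf]; rfl) ?_
    simp only [simExt_cell hj]
    refine .send (by simp only [simEMPC, κ.dec_enc, simInstr]; rfl) ?_
    refine ih (fun i' h => hl i' (List.mem_cons_of_mem _ h)) _ ?_
    simpa [hf, PRAM.nextState] using h

/-- Invariant: each cell of machine `j` already has its value in `mem'` or a write to it is still
waiting. By `hl` every request writes the value of `mem'`, so order and repetition do no harm. -/
theorem localRun_serve_writes {j : Fin p} {mem' : Fin M → BitVec w} {st st' : Fin P → BitVec s}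
    {b : Bool} {out : List (Fin p × BitVec μ)} (l : List (Fin P))
    (hl : ∀ i ∈ l, ∃ a q, A.action i (st i) = .write a (mem' a) q ∧ owner a = j) :
    ∀ mem : Fin M → BitVec w,
    (∀ a, owner a = j → mem a = mem' a ∨ ∃ i ∈ l, (A.action i (st i)).writeAddr = some a) →
    LocalRun ((simEMPC A owner head κ).program j)
      ⟨κ.enc (.serve b), simExt owner head j mem st', l.map fun i => κ.menc (i, st i), out⟩
      ⟨κ.enc .absorb, simExt owner head j mem' st', [], out⟩ b := by
  induction l with
  | nil =>
    intro mem h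
    rw [simExt_congr (mem' := mem') (st' := st') (fun a ha => by simpa using h a ha)
      (fun _ => rfl)]
    refine .receive (by simp only [simEMPC, κ.dec_enc, simInstr]; rfl) ?_
    exact .endRound (by simp only [simEMPC, κ.dec_enc, simInstr, List.map_nil, List.head?_nil,
      Option.map_none])
  | cons i l ih =>
    intro mem h
    obtain ⟨a, q, ha, hj⟩ := hl i (by simp)
    refine .receive (by simp only [simEMPC, κ.dec_enc, simInstr]; rfl) ?_
    simp only [List.map_cons, List.head?_cons, Option.map_some, κ.mdec_menc, List.tail_cons]
    refine .write (by simp only [simEMPC, κ.dec_enc, simInstr, ha]; rfl) ?_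
    simp only [update_simExt_cell hj]
    refine ih (fun i' h => hl i' (List.mem_cons_of_mem _ h)) _ fun a' ha' => ?_
    by_cases haa : a' = a
    · subst haa; simp
    · rcases h a' ha' with h | ⟨i', hi', hw⟩
      · simp [Function.update_of_ne haa, h]
      · rcases List.mem_cons.1 hi' with rfl | hi'
        · simp [ha, PRAMAction.writeAddr, Ne.symm haa] at hw
        · exact .inr ⟨i', hi', hw⟩

end LocalRuns

/-! ### Rounds -/

theorem flatMap_ite_eq {α β : Type*} [DecidableEq α] {a : α} (L : List β) {l : List α}
    (hl : l.Nodup) (ha : a ∈ l) : (l.flatMap fun b => if b = a then L else []) = L := by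
  induction l with
  | nil => simp at ha
  | cons b l ih =>
    rw [List.nodup_cons] at hl
    by_cases hb : b = a
    · subst hb
      have : (l.flatMap fun b' => if b' = b then L else []) = [] := by
        rw [List.flatMap_eq_nil_iff]
        intro b' hb'
        rw [if_neg]
        rintro rfl
        exact hl.1 hb'
      simp [this]
    · simp [hb, ih hl.2 ((List.mem_cons.1 ha).resolve_left (Ne.symm hb))]

theorem filterMap_filterMap_eq_map_filter {ι α β : Type*} [DecidableEq α] (l : List ι)
    (g : ι → Option α) (h : ι → β) (j : α) :
    ((l.filterMap fun i => (g i).map fun a => (a, h i)).filterMap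
      fun d => if d.1 = j then some d.2 else none) =
      (l.filter fun i => decide (g i = some j)).map h := by
  induction l with
  | nil => rfl
  | cons i l ih =>
    cases hg : g i with
    | none => simp [hg, ih]
    | some a => by_cases ha : a = j <;> simp [hg, ih, ha]

/-- The messages that machine `j` receives when each machine `i` sends `out i`. -/
def deliver (out : Fin p → List (Fin p × BitVec μ)) (j : Fin p) : List (BitVec μ) :=
  (List.finRange p).flatMap fun i => (out i).filterMap fun d => if d.1 = j then some d.2 else none

theorem length_deliver_le {out : Fin p → List (Fin p × BitVec μ)} {N : ℕ}
    (h : ∀ i, (out i).length ≤ N) (j : Fin p) : (deliver out j).length ≤ p * N := by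
  rw [deliver, List.length_flatMap]
  refine (List.sum_le_card_nsmul _ N fun n hn => ?_).trans (by simp)
  obtain ⟨i, -, rfl⟩ := List.mem_map.1 hn
  exact (List.length_filterMap_le _ _).trans (h i)

variable (A : PRAM P M w s) (owner : Fin M → Fin p) (head : Fin p) (κ : SimCodec P s m μ)

/-- The processors that read a cell of machine `j`. -/
def cellReaders (c : PRAMConfig P M w s) (j : Fin p) : List (Fin P) :=
  (List.finRange P).filter fun i => decide ((A.action i (c.state i)).readAddr.map owner = some j)

/-- The processors that write a cell of machine `j`. -/
def cellWriters (c : PRAMConfig P M w s) (j : Fin p) : List (Fin P) :=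
  (List.finRange P).filter fun i => decide ((A.action i (c.state i)).writeAddr.map owner = some j)

/-- The states after a step, where those that depend on a read are still missing. -/
def pendingStates (c : PRAMConfig P M w s) (i : Fin P) : BitVec s :=
  (A.action i (c.state i)).pendingState (c.state i)

/-- Whether all processors halt. -/
def allHaltFlag (c : PRAMConfig P M w s) : Bool :=
  (List.finRange P).all fun i => (A.action i (c.state i)).isHalt

theorem allHaltFlag_iff (c : PRAMConfig P M w s) : allHaltFlag A c = true ↔ A.AllHalt c := by
  simp [allHaltFlag, PRAM.AllHalt, PRAMAction.isHalt_iff]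

/-- The messages sent by machine `j` in an odd round. -/
def requests (c : PRAMConfig P M w s) (j : Fin p) : List (Fin p × BitVec μ) :=
  if j = head then
    ((List.finRange P).filterMap fun i =>
      (A.action i (c.state i)).readAddr.map fun a => (owner a, κ.menc (i, c.state i))) ++
    (List.finRange P).filterMap fun i =>
      (A.action i (c.state i)).writeAddr.map fun a => (owner a, κ.menc (i, c.state i))
  else []

/-- The messages sent by machine `j` in an even round. -/
def replies (c : PRAMConfig P M w s) (j : Fin p) : List (Fin p × BitVec μ) :=
  (cellReaders A owner c j).map fun i =>
    (head, κ.menc (i, PRAM.nextState (A.action i (c.state i)) c.mem (c.state i)))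

theorem length_requests_le (c : PRAMConfig P M w s) (j : Fin p) :
    (requests A owner head κ c j).length ≤ 2 * P := by
  unfold requests
  split
  · rw [List.length_append, two_mul]
    exact Nat.add_le_add ((List.length_filterMap_le _ _).trans (by simp))
      ((List.length_filterMap_le _ _).trans (by simp))
  · simp

/-- The bound `P` would do; `2 * P` is the one shared with the requests. -/
theorem length_replies_le (c : PRAMConfig P M w s) (j : Fin p) :
    (replies A owner head κ c j).length ≤ 2 * P := by
  rw [replies, List.length_map, cellReaders]
  refine (List.length_filter_le _ _).trans ?_
  simp only [List.length_finRange]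
  omega

/-- Only `head` contributes to the inboxes, and its reads were sent before its writes. -/
theorem deliver_requests (c : PRAMConfig P M w s) (j : Fin p) :
    deliver (requests A owner head κ c) j =
      ((cellReaders A owner c j).map fun i => κ.menc (i, c.state i)) ++
        (cellWriters A owner c j).map fun i => κ.menc (i, c.state i) := by
  have h1 := filterMap_filterMap_eq_map_filter (List.finRange P)
    (fun i => (A.action i (c.state i)).readAddr.map owner) (fun i => κ.menc (i, c.state i)) j
  have h2 := filterMap_filterMap_eq_map_filter (List.finRange P)
    (fun i => (A.action i (c.state i)).writeAddr.map owner) (fun i => κ.menc (i, c.state i)) j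
  simp only [Option.map_map, Function.comp_def] at h1 h2
  rw [cellReaders, cellWriters, ← h1, ← h2, ← List.filterMap_append]
  rw [← flatMap_ite_eq (a := head) (List.filterMap _ _) (List.nodup_finRange p)
    (List.mem_finRange head), deliver]
  congr 1
  funext i
  by_cases hi : i = head <;> simp [requests, hi]

/-- A reader is answered by the owner of its cell; for every other processor the pending state is
already the next state. -/
theorem exists_deliver_replies (c : PRAMConfig P M w s) :
    ∃ l : List (Fin P × BitVec s), deliver (replies A owner head κ c) head = l.map κ.menc ∧
      (∀ r ∈ l, r.2 = (A.step c).state r.1) ∧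
      ∀ i, pendingStates A c i = (A.step c).state i ∨ ∃ r ∈ l, r.1 = i := by
  refine ⟨(List.finRange p).flatMap fun j => (cellReaders A owner c j).map fun i =>
    (i, (A.step c).state i), ?_, ?_, fun i => ?_⟩
  · rw [deliver, List.map_flatMap]
    congr 1
    funext j
    simp [replies, List.filterMap_map, Function.comp_def, PRAM.step]
  · intro r hr
    simp only [List.mem_flatMap, List.mem_map] at hr
    obtain ⟨j, -, i, -, rfl⟩ := hr
    rfl
  · cases ha : (A.action i (c.state i)).readAddr with
    | none => exact .inl (PRAMAction.pendingState_eq_nextState ha _ _)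
    | some a =>
      refine .inr ⟨(i, (A.step c).state i), ?_, rfl⟩
      simp only [List.mem_flatMap, List.mem_map]
      exact ⟨owner a, List.mem_finRange _, i, by simp [cellReaders, ha], rfl⟩

/-! ### Configurations between rounds -/

/-- The configuration of the simulation after `2 * k` rounds. -/
def idleConfig (x : Fin M → BitVec w) : ℕ → EMPCConfig p (w + s) (M + P) m μ
  | 0 => ⟨fun _ => κ.enc .absorb, fun j => simExt owner head j x fun _ => 0, fun _ => [],
      fun _ => false⟩
  | k + 1 => ⟨fun _ => κ.enc .absorb,
      fun j => simExt owner head j (A.config x (k + 1)).mem (pendingStates A (A.config x k)),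
      deliver (replies A owner head κ (A.config x k)),
      fun j => if j = head then allHaltFlag A (A.config x k) else true⟩

/-- The configuration of the simulation after `2 * k + 1` rounds. -/
def busyConfig (x : Fin M → BitVec w) (k : ℕ) : EMPCConfig p (w + s) (M + P) m μ :=
  ⟨fun j => κ.enc (.serve (if j = head then allHaltFlag A (A.config x k) else true)),
    fun j => simExt owner head j (A.config x k).mem (pendingStates A (A.config x k)),
    deliver (requests A owner head κ (A.config x k)), fun _ => false⟩

theorem idleConfig_main (x : Fin M → BitVec w) (k : ℕ) (j : Fin p) :
    (idleConfig A owner head κ x k).main j = κ.enc .absorb := by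
  cases k <;> rfl

/-- Absorbing the waiting replies makes all processor states current. -/
theorem exists_idleConfig (x : Fin M → BitVec w) (k : ℕ) :
    ∃ (st : Fin P → BitVec s) (l : List (Fin P × BitVec s)),
      (∀ j, (idleConfig A owner head κ x k).ext j =
        simExt owner head j (A.config x k).mem st) ∧
      (idleConfig A owner head κ x k).inbox head = l.map κ.menc ∧
      (∀ r ∈ l, r.2 = (A.config x k).state r.1) ∧
      ∀ i, st i = (A.config x k).state i ∨ ∃ r ∈ l, r.1 = i := by
  cases k with
  | zero => exact ⟨fun _ => 0, [], fun _ => rfl, rfl, by simp, fun _ => .inl rfl⟩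
  | succ k =>
    obtain ⟨l, h1, h2, h3⟩ := exists_deliver_replies A owner head κ (A.config x k)
    rw [← PRAM.config_succ] at h2 h3
    exact ⟨pendingStates A (A.config x k), l, fun _ => rfl, h1, h2, h3⟩

theorem round_idleConfig_busyConfig (x : Fin M → BitVec w) (k : ℕ) :
    (simEMPC A owner head κ).Round (idleConfig A owner head κ x k)
      (busyConfig A owner head κ x k) := by
  obtain ⟨st, l, hext, hinb, hl, hst⟩ := exists_idleConfig A owner head κ x k
  refine ⟨requests A owner head κ (A.config x k),
    -- Machines other than `head` take no message in this round. `Round` discards whatever is left,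
    -- so their inboxes need not be shown empty.
    fun j => if j = head then [] else (idleConfig A owner head κ x k).inbox j, fun j => ?_,
    fun j => rfl⟩
  rw [idleConfig_main, hext]
  by_cases hj : j = head
  · subst hj
    rw [hinb]
    simp only [busyConfig, requests, if_true]
    refine localRun_absorb (st' := (A.config x k).state) ?_ l hl st hst
    refine localRun_scanReads 0 [] ?_
    exact localRun_scanWrites (st := (A.config x k).state) 0 (A.config x k).state true _ (by simp)
  · have := EMPC.LocalRun.endRound (prog := (simEMPC A owner head κ).program j)
      (σ := ⟨κ.enc .absorb, simExt owner head j (A.config x k).mem st,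
        (idleConfig A owner head κ x k).inbox j, []⟩)
      (by simp only [simEMPC, κ.dec_enc, simInstr, if_neg hj]; rfl)
    simpa [busyConfig, requests, hj, simExt_congr (st := pendingStates A (A.config x k)) (st' := st)
      (fun _ _ => rfl) (fun h => absurd h hj)] using this

theorem round_busyConfig_idleConfig {x : Fin M → BitVec w} {t k : ℕ}
    (hex : A.ExclusiveWrite x t) (hk : k < t) :
    (simEMPC A owner head κ).Round (busyConfig A owner head κ x k)
      (idleConfig A owner head κ x (k + 1)) := by
  refine ⟨replies A owner head κ (A.config x k), fun _ => [], fun j => ?_, fun j => rfl⟩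
  simp only [busyConfig, idleConfig, deliver_requests]
  refine localRun_serve_reads _ (fun i hi => ?_) [] ?_
  · simpa [cellReaders] using hi
  rw [PRAM.config_succ]
  refine localRun_serve_writes _ (fun i hi => ?_) _ fun a ha => ?_
  · simp only [cellWriters, List.mem_filter, List.mem_finRange, true_and, decide_eq_true_eq,
      Option.map_eq_some_iff] at hi
    obtain ⟨a, ha, hj⟩ := hi
    obtain ⟨v, q, h⟩ := PRAMAction.writeAddr_eq_some_iff.1 ha
    refine ⟨a, q, ?_, hj⟩
    rw [PRAM.step_mem_of_write A _ (hex k hk) (PRAMAction.writeTo_eq_some_iff.2 ⟨q, h⟩), h]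
  -- A cell of `j` with a writer has its request in this inbox; a cell without a writer keeps its
  -- content.
  · by_cases hw : ∃ i, (A.action i ((A.config x k).state i)).writeAddr = some a
    · obtain ⟨i, hi⟩ := hw
      exact .inr ⟨i, by simp [cellWriters, hi, ha], hi⟩
    · refine .inl (PRAM.step_mem_of_not_write A _ fun i => ?_).symm
      rw [Option.eq_none_iff_forall_ne_some]
      intro v hv
      obtain ⟨q, h⟩ := PRAMAction.writeTo_eq_some_iff.1 hv
      exact hw ⟨i, PRAMAction.writeAddr_eq_some_iff.2 ⟨v, q, h⟩⟩

/-! ### The whole run: storage, termination and external memory -/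

/-- The configuration of the simulation after `r` rounds. -/
def simConfig (x : Fin M → BitVec w) (r : ℕ) : EMPCConfig p (w + s) (M + P) m μ :=
  if r % 2 = 0 then idleConfig A owner head κ x (r / 2) else busyConfig A owner head κ x (r / 2)

theorem simConfig_even (x : Fin M → BitVec w) (k : ℕ) :
    simConfig A owner head κ x (2 * k) = idleConfig A owner head κ x k := by
  simp [simConfig]

theorem simConfig_odd (x : Fin M → BitVec w) (k : ℕ) :
    simConfig A owner head κ x (2 * k + 1) = busyConfig A owner head κ x k := by
  have h1 : (2 * k + 1) % 2 = 1 := by omega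
  have h2 : (2 * k + 1) / 2 = k := by omega
  simp [simConfig, h1, h2]

theorem round_simConfig {x : Fin M → BitVec w} {t r : ℕ} (hex : A.ExclusiveWrite x t)
    (hr : r < 2 * t) :
    (simEMPC A owner head κ).Round (simConfig A owner head κ x r)
      (simConfig A owner head κ x (r + 1)) := by
  obtain ⟨k, rfl | rfl⟩ := Nat.even_or_odd' r
  · rw [simConfig_even, simConfig_odd]
    exact round_idleConfig_busyConfig A owner head κ x k
  · rw [simConfig_odd, show 2 * k + 1 + 1 = 2 * (k + 1) by ring, simConfig_even]
    exact round_busyConfig_idleConfig A owner head κ hex (by omega)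

theorem length_inbox_simConfig_le (x : Fin M → BitVec w) (r : ℕ) (j : Fin p) :
    ((simConfig A owner head κ x r).inbox j).length ≤ p * (2 * P) := by
  obtain ⟨k, rfl | rfl⟩ := Nat.even_or_odd' r
  · rw [simConfig_even]
    cases k with
    | zero => simp [idleConfig]
    | succ k => exact length_deliver_le (length_replies_le A owner head κ _) j
  · rw [simConfig_odd]
    exact length_deliver_le (length_requests_le A owner head κ _) j

theorem isInitial_simConfig (x : Fin M → BitVec w) :
    EMPC.IsInitial owner (Fin.castAdd P) (simConfig A owner head κ x 0) x := by
  have h0 : simConfig A owner head κ x 0 = idleConfig A owner head κ x 0 :=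
    simConfig_even A owner head κ x 0
  rw [h0]
  refine ⟨fun a => by simp [idleConfig, simExt], fun j e => ?_, fun _ => κ.enc_absorb,
    fun _ => rfl, fun _ => rfl⟩
  refine Fin.addCases (fun a => ?_) (fun i => ?_) e
  · intro h
    have : owner a ≠ j := fun ha => h a (by rw [ha])
    simp [idleConfig, simExt, this]
  · simp [idleConfig, simExt]

theorem stores_simConfig (x : Fin M → BitVec w) (k : ℕ) :
    EMPC.Stores owner (Fin.castAdd P) (simConfig A owner head κ x (2 * k)) (A.config x k).mem := by
  intro a
  obtain ⟨st, -, h, -⟩ := exists_idleConfig A owner head κ x k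
  rw [simConfig_even, h]
  simp [simExt]

/-- The vote of `head` decides: it is negative initially and after odd rounds, and after round `2 *
(k + 1)` it is the halting test of `A.config x k`. -/
theorem terminated_simConfig_iff (x : Fin M → BitVec w) (r : ℕ) :
    EMPC.Terminated (simConfig A owner head κ x r) ↔
      ∃ k, r = 2 * (k + 1) ∧ A.AllHalt (A.config x k) := by
  obtain ⟨k, rfl | rfl⟩ := Nat.even_or_odd' r
  · rw [simConfig_even]
    cases k with
    | zero =>
      refine ⟨fun h => by simpa [idleConfig] using h head, ?_⟩
      rintro ⟨k, hk, -⟩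
      omega
    | succ k =>
      constructor
      · intro h
        exact ⟨k, rfl, (allHaltFlag_iff A _).1 (by simpa [idleConfig] using h head)⟩
      · rintro ⟨k', hk, h⟩ j
        obtain rfl : k = k' := by omega
        simp [idleConfig, (allHaltFlag_iff A _).2 h]
  · rw [simConfig_odd]
    refine ⟨fun h => by simpa [busyConfig] using h head, ?_⟩
    rintro ⟨k', hk, -⟩
    omega

theorem runsInRounds_simConfig {x : Fin M → BitVec w} {t : ℕ} (h : A.RunsInTime x t) :
    EMPC.RunsInRounds (simConfig A owner head κ x) (2 * t) := by
  obtain ⟨k, rfl, hk, hlt⟩ := h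
  refine ⟨(terminated_simConfig_iff A owner head κ x _).2 ⟨k, rfl, hk⟩, fun r hr hterm => ?_⟩
  obtain ⟨k', rfl, hk'⟩ := (terminated_simConfig_iff A owner head κ x r).1 hterm
  exact hlt k' (by omega) hk'

/-- The crude count of `2 * P` messages from each of `p` senders to each of `p` receivers, for the
inboxes before and after the round, gives `4 * p ^ 2 * P`. -/
theorem totalExternalBits_simConfig_le (x : Fin M → BitVec w) (r : ℕ) :
    (simEMPC A owner head κ).totalExternalBits (simConfig A owner head κ x r)
      (simConfig A owner head κ x (r + 1)) ≤
      p * ((M + P) * (w + s)) + μ * (4 * p ^ 2 * P) := by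
  have h (r : ℕ) : ∑ i, ((simConfig A owner head κ x r).inbox i).length ≤ p * (p * (2 * P)) := by
    refine (Finset.sum_le_card_nsmul _ _ _
      fun j _ => length_inbox_simConfig_le A owner head κ x r j).trans (by simp)
  unfold EMPC.totalExternalBits
  gcongr
  exact (Nat.add_le_add (h r) (h (r + 1))).trans (by apply le_of_eq; ring)

end Simulation

/-! ### The constant -/

theorem natLog_two_le {n : ℕ} (hn : 0 < n) : (Nat.log 2 n : ℝ) ≤ Real.log n / Real.log 2 := by
  rw [le_div_iff₀ (Real.log_pos (by norm_num)), ← Real.log_pow]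
  refine Real.log_le_log (by positivity) ?_
  exact_mod_cast Nat.pow_log_le_self 2 hn.ne'

theorem mainTheorem5 (p : ℕ) (hp : 0 < p) (K : ℝ) :
    ∃ C : ℝ, 0 < C ∧
      ∀ (P M w s : ℕ), 2 ≤ P * M →
        ((w : ℝ) + (s : ℝ)) ≤ K * (Real.log P + Real.log M) →
        ∀ (A : PRAM P M w s) (owner : Fin M → Fin p),
          ∃ (E m μ : ℕ) (B : EMPC p (w + s) E m μ) (loc : Fin M → Fin E),
            Function.Injective (fun a => (owner a, loc a)) ∧
            (B.totalMainBits : ℝ) ≤ C * (Real.log P + Real.log M) ∧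
            ∀ (x : Fin M → BitVec w) (t : ℕ), A.ExclusiveWrite x t →
              ∃ c : ℕ → EMPCConfig p (w + s) E m μ,
                EMPC.IsInitial owner loc (c 0) x ∧
                (∀ r < 2 * t, B.Round (c r) (c (r + 1))) ∧
                (∀ r < 2 * t, (B.totalExternalBits (c r) (c (r + 1)) : ℝ) ≤
                  C * ((Real.log P + Real.log M) * ((P : ℝ) + (M : ℝ)))) ∧
                (∀ k ≤ t, EMPC.Stores owner loc (c (2 * k)) (A.config x k).mem) ∧
                (A.RunsInTime x t → EMPC.RunsInRounds c (2 * t)) := by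
  have hlog2 : 0 < Real.log 2 := Real.log_pos (by norm_num)
  have hp1 : (1 : ℝ) ≤ p := by exact_mod_cast hp
  -- Per machine, main memory has `2 * Nat.log 2 P + 8 + (w + s) + 2 * s` bits: the first two terms
  -- give the 10, the last two the 3. The absolute value covers negative `K`.
  set D : ℝ := 10 / Real.log 2 + 3 * |K| with hD
  have hDpos : 0 < D := by positivity
  -- The 5 is 1 for the words of external memory plus 4 for the messages.
  refine ⟨5 * (p : ℝ) ^ 2 * D, by positivity, fun P M w s hPM hws A owner => ?_⟩
  have hP : 0 < P := Nat.pos_of_ne_zero fun h => by simp [h] at hPM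
  have hM : 0 < M := Nat.pos_of_ne_zero fun h => by simp [h] at hPM
  have hP' : (0 : ℝ) < P := by exact_mod_cast hP
  have hM' : (0 : ℝ) < M := by exact_mod_cast hM
  set L : ℝ := Real.log P + Real.log M with hL
  -- Here `2 ≤ P * M` is needed: it bounds `L` away from zero, so that additive constants are
  -- absorbed into multiples of `L`.
  have hL2 : Real.log 2 ≤ L := by
    rw [hL, ← Real.log_mul hP'.ne' hM'.ne']
    exact Real.log_le_log (by norm_num) (by exact_mod_cast hPM)
  have hLpos : 0 < L := hlog2.trans_le hL2
  have hone : 1 ≤ L / Real.log 2 := (one_le_div hlog2).2 hL2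
  have hlogP : (Nat.log 2 P : ℝ) ≤ L / Real.log 2 := by
    refine (natLog_two_le hP).trans ?_
    gcongr
    have : 0 ≤ Real.log M := Real.log_natCast_nonneg M
    linarith
  have hws' : (w : ℝ) + s ≤ |K| * L := hws.trans (by gcongr; exact le_abs_self K)
  have hs : (s : ℝ) ≤ |K| * L := by
    have : (0 : ℝ) ≤ w := Nat.cast_nonneg w
    linarith
  have hDL : D * L = 10 * (L / Real.log 2) + 3 * (|K| * L) := by rw [hD]; ring
  have hKL : 0 ≤ |K| * L := by positivity
  have hp2 : (p : ℝ) ≤ (p : ℝ) ^ 2 := by nlinarith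
  obtain ⟨κ⟩ := nonempty_simCodec hP s
  refine ⟨M + P, _, _, simEMPC A owner ⟨0, hp⟩ κ, Fin.castAdd P, ?_, ?_, fun x t hex => ?_⟩
  · exact fun a a' h => Fin.castAdd_injective M P (Prod.ext_iff.1 h).2
  · unfold EMPC.totalMainBits
    push_cast
    calc (p : ℝ) * ((Nat.log 2 P + s + 7) + (w + s) + (Nat.log 2 P + s + 1))
        ≤ p * (D * L) := by gcongr; linarith
      _ ≤ (5 * (p : ℝ) ^ 2) * (D * L) := by gcongr; linarith
      _ = 5 * (p : ℝ) ^ 2 * D * L := by ring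
  · refine ⟨simConfig A owner ⟨0, hp⟩ κ x, isInitial_simConfig A owner _ κ x,
      fun r hr => round_simConfig A owner _ κ hex hr, fun r _ => ?_,
      fun k _ => stores_simConfig A owner _ κ x k, runsInRounds_simConfig A owner _ κ⟩
    refine (Nat.cast_le.2 (totalExternalBits_simConfig_le A owner _ κ x r)).trans ?_
    push_cast
    calc (p : ℝ) * ((M + P) * (w + s)) + (Nat.log 2 P + s + 1) * (4 * p ^ 2 * P)
        ≤ p ^ 2 * ((M + P) * (D * L)) + (D * L) * (4 * p ^ 2 * (P + M)) := by
          gcongr <;> linarith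
      _ = 5 * (p : ℝ) ^ 2 * D * (L * (P + M)) := by ring
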